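/- Let $k$ be an algebraically closed field of arbitrary characteristic and let $f_0,\ldots,f_n\in k[X_0,\ldots,X_m]$ be homogeneous polynomials of a common degree $d$ with $\gcd(f_0,\ldots,f_n)=1$. Let $\phi=(f_0:\cdots:f_n):\mathbb{P}^m_k\dashrightarrow\mathbb{P}^n_k$ be the rational map they define, with domain $\Omega_\phi=\mathbb{P}^m_k\setminus Z(f_0,\ldots,f_n)$, and let $J(f)=\left(\partial f_i/\partial X_j\right)_{0\le i\le n,\,0\le j\le m}$ be the Jacobian matrix. Let $V\subset\mathbb{P}^m_k$ be a subvariety (a closed irreducible subset) with $V\cap\Omega_\phi\neq\emptyset$, let $\phi(V)$ denote the Zariski closure of $\phi(V\cap\Omega_\phi)$ in $\mathbb{P}^n_k$, and let $r\in\mathbb{N}$ be such that $r=\dim V-\dim\phi(V)$. Then $$V\subset Z\bigl(I_{m-r+2}(J(f))\bigr),$$ where $I_{m-r+2}(J(f))\subset k[X_0,\ldots,X_m]$ is the ideal generated by the $(m-r+2)$-minors of $J(f)$ (the zero ideal if $m-r+2>\min\{m+1,n+1\}$). -/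

import Mathlib

/-- The set of closed points of `ℙ^m` over `k` (for `k` algebraically closed): lines through the
origin in `k^(m+1)`.  A type synonym, so that it can carry the Zariski topology. -/
def ProjSpace (k : Type*) [Field k] (m : ℕ) : Type _ :=
  Projectivization k (Fin (m + 1) → k)

namespace ProjSpace

variable {k : Type*} [Field k] {m n : ℕ}

/-- The point `(v_0 : ... : v_m)`. -/
def mk (v : Fin (m + 1) → k) (hv : v ≠ 0) : ProjSpace k m :=
  Projectivization.mk k v hv

/-- A chosen vector of homogeneous coordinates of a point. -/
noncomputable def rep (x : ProjSpace k m) : Fin (m + 1) → k :=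
  Projectivization.rep x

theorem rep_ne_zero (x : ProjSpace k m) : x.rep ≠ 0 :=
  Projectivization.rep_nonzero x

theorem mk_rep (x : ProjSpace k m) : mk x.rep x.rep_ne_zero = x :=
  Projectivization.mk_rep x

theorem mk_eq_mk_iff {v w : Fin (m + 1) → k} (hv : v ≠ 0) (hw : w ≠ 0) :
    mk v hv = mk w hw ↔ ∃ a : k, a • w = v :=
  Projectivization.mk_eq_mk_iff' k v w hv hw

/-- The projective zero locus of a set `S` of polynomials: the points all of whose homogeneous
coordinate vectors are zeros of every element of `S`. -/
def zeroLocus (S : Set (MvPolynomial (Fin (m + 1)) k)) : Set (ProjSpace k m) :=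
  {x | ∀ g ∈ S, ∀ (v : Fin (m + 1) → k) (hv : v ≠ 0), mk v hv = x → MvPolynomial.eval v g = 0}

theorem eval_smul_of_isHomogeneous {g : MvPolynomial (Fin (m + 1)) k} {d : ℕ}
    (hg : g.IsHomogeneous d) (a : k) (v : Fin (m + 1) → k) :
    MvPolynomial.eval (a • v) g = a ^ d * MvPolynomial.eval v g := by
  rw [MvPolynomial.eval_eq', MvPolynomial.eval_eq', Finset.mul_sum]
  refine Finset.sum_congr rfl fun e he => ?_
  have hd : ∑ i, e i = d := by
    have h := hg (MvPolynomial.mem_support_iff.mp he)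
    rw [Finsupp.weight_apply, Finsupp.sum_fintype _ _ (by simp)] at h
    simpa using h
  simp only [Pi.smul_apply, smul_eq_mul, mul_pow, Finset.prod_mul_distrib,
    Finset.prod_pow_eq_pow_sum, hd]
  ring

/-- For a homogeneous polynomial, vanishing at a point can be tested on any one coordinate
vector. -/
theorem eval_eq_zero_iff_of_mk_eq {g : MvPolynomial (Fin (m + 1)) k} {d : ℕ}
    (hg : g.IsHomogeneous d) {v w : Fin (m + 1) → k} {hv : v ≠ 0} {hw : w ≠ 0}
    (h : mk v hv = mk w hw) : MvPolynomial.eval v g = 0 ↔ MvPolynomial.eval w g = 0 := by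
  obtain ⟨a, rfl⟩ := (mk_eq_mk_iff hv hw).mp h
  have ha : a ≠ 0 := fun h0 => hv (by simp [h0])
  rw [eval_smul_of_isHomogeneous hg, mul_eq_zero_iff_left (pow_ne_zero d ha)]

theorem mem_zeroLocus_iff {S : Set (MvPolynomial (Fin (m + 1)) k)}
    (hS : ∀ g ∈ S, ∃ d, g.IsHomogeneous d) (x : ProjSpace k m) :
    x ∈ zeroLocus S ↔ ∀ g ∈ S, MvPolynomial.eval x.rep g = 0 := by
  constructor
  · intro h g hg
    exact h g hg _ x.rep_ne_zero x.mk_rep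
  · intro h g hg v hv hvx
    obtain ⟨d, hd⟩ := hS g hg
    exact (eval_eq_zero_iff_of_mk_eq hd (hvx.trans x.mk_rep.symm)).mpr (h g hg)

/-- The Zariski topology: the closed sets are the zero loci of sets of homogeneous polynomials. -/
instance zariskiTopology : TopologicalSpace (ProjSpace k m) :=
  TopologicalSpace.ofClosed
    {Z | ∃ S : Set (MvPolynomial (Fin (m + 1)) k),
      (∀ g ∈ S, ∃ d, g.IsHomogeneous d) ∧ Z = zeroLocus S}
    (by
      refine ⟨{1}, ?_, ?_⟩
      · rintro g rfl
        exact ⟨0, MvPolynomial.isHomogeneous_one _ _⟩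
      · ext x
        simp only [Set.mem_empty_iff_false, false_iff]
        intro h
        simpa using h 1 rfl _ x.rep_ne_zero x.mk_rep)
    (by
      intro A hA
      have hA' : ∀ Z, ∃ S : Set (MvPolynomial (Fin (m + 1)) k),
          Z ∈ A → (∀ g ∈ S, ∃ d, g.IsHomogeneous d) ∧ Z = zeroLocus S := by
        intro Z
        by_cases hZ : Z ∈ A
        · obtain ⟨S, hS⟩ := hA hZ
          exact ⟨S, fun _ => hS⟩
        · exact ⟨∅, fun h => absurd h hZ⟩
      choose S hS using hA'
      refine ⟨⋃ Z ∈ A, S Z, ?_, ?_⟩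
      · intro g hg
        simp only [Set.mem_iUnion] at hg
        obtain ⟨Z, hZA, hg⟩ := hg
        exact (hS Z hZA).1 g hg
      · ext x
        constructor
        · intro hx g hg
          simp only [Set.mem_iUnion] at hg
          obtain ⟨Z, hZA, hg⟩ := hg
          have hxZ := hx Z hZA
          rw [(hS Z hZA).2] at hxZ
          exact hxZ g hg
        · intro hx Z hZA
          rw [(hS Z hZA).2]
          intro g hg
          exact hx g (Set.mem_biUnion hZA hg))
    (by
      rintro _ ⟨S, hS, rfl⟩ _ ⟨T, hT, rfl⟩
      have hST : ∀ g ∈ Set.image2 (· * ·) S T, ∃ d, g.IsHomogeneous d := by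
        rintro _ ⟨g, hg, h, hh, rfl⟩
        obtain ⟨d, hd⟩ := hS g hg
        obtain ⟨e, he⟩ := hT h hh
        exact ⟨d + e, hd.mul he⟩
      refine ⟨Set.image2 (· * ·) S T, hST, ?_⟩
      ext x
      rw [Set.mem_union, mem_zeroLocus_iff hS, mem_zeroLocus_iff hT, mem_zeroLocus_iff hST]
      constructor
      · rintro (h | h) _ ⟨a, ha, b, hb, rfl⟩
        · simp [h a ha]
        · simp [h b hb]
      · intro h
        by_contra! hc
        obtain ⟨⟨a, ha, ha0⟩, ⟨b, hb, hb0⟩⟩ := hc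
        have := h _ ⟨a, ha, b, hb, rfl⟩
        simp [ha0, hb0] at this)

theorem isClosed_iff {Z : Set (ProjSpace k m)} :
    IsClosed Z ↔ ∃ S : Set (MvPolynomial (Fin (m + 1)) k),
      (∀ g ∈ S, ∃ d, g.IsHomogeneous d) ∧ Z = zeroLocus S := by
  rw [← isOpen_compl_iff]
  change Zᶜᶜ ∈ _ ↔ _
  rw [compl_compl]
  rfl

/-- The domain `Ω = ℙ^m \ Z(f_0, ..., f_n)` of the rational map `(f_0 : ... : f_n)`. -/
def domain (f : Fin (n + 1) → MvPolynomial (Fin (m + 1)) k) : Set (ProjSpace k m) :=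
  (zeroLocus (Set.range f))ᶜ

theorem eval_ne_zero_of_mem_domain {f : Fin (n + 1) → MvPolynomial (Fin (m + 1)) k} {d : ℕ}
    (hf : ∀ i, (f i).IsHomogeneous d) {x : ProjSpace k m} (hx : x ∈ domain f) :
    (fun i => MvPolynomial.eval x.rep (f i)) ≠ 0 := by
  intro h
  refine hx ((mem_zeroLocus_iff ?_ x).mpr ?_)
  · rintro _ ⟨i, rfl⟩
    exact ⟨d, hf i⟩
  · rintro _ ⟨i, rfl⟩
    exact congrFun h i

/-- The morphism `φ : Ω → ℙ^n`, `x ↦ (f_0(x) : ... : f_n(x))`, for homogeneous polynomials `f_i`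
of a common degree `d`. -/
noncomputable def ratMap (f : Fin (n + 1) → MvPolynomial (Fin (m + 1)) k) {d : ℕ}
    (hf : ∀ i, (f i).IsHomogeneous d) (x : domain f) : ProjSpace k n :=
  mk (fun i => MvPolynomial.eval x.1.rep (f i)) (eval_ne_zero_of_mem_domain hf x.2)

/-- `ratMap` does not depend on the choice of homogeneous coordinates. -/
theorem ratMap_mk (f : Fin (n + 1) → MvPolynomial (Fin (m + 1)) k) {d : ℕ}
    (hf : ∀ i, (f i).IsHomogeneous d) (v : Fin (m + 1) → k) (hv : v ≠ 0)
    (hx : mk v hv ∈ domain f) (hfv : (fun i => MvPolynomial.eval v (f i)) ≠ 0) :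
    ratMap f hf ⟨mk v hv, hx⟩ = mk (fun i => MvPolynomial.eval v (f i)) hfv := by
  refine (mk_eq_mk_iff _ _).mpr ?_
  obtain ⟨a, ha⟩ := (mk_eq_mk_iff (mk v hv).rep_ne_zero hv).mp (mk v hv).mk_rep
  refine ⟨a ^ d, funext fun i => ?_⟩
  change a ^ d * MvPolynomial.eval v (f i) = MvPolynomial.eval (mk v hv).rep (f i)
  rw [← eval_smul_of_isHomogeneous (hf i), ha]

/-- The closed image `φ(V)`: the Zariski closure in `ℙ^n` of the set of all `φ(x)` with
`x ∈ V ∩ Ω`. -/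
noncomputable def closedImage (f : Fin (n + 1) → MvPolynomial (Fin (m + 1)) k) {d : ℕ}
    (hf : ∀ i, (f i).IsHomogeneous d) (V : Set (ProjSpace k m)) : Set (ProjSpace k n) :=
  closure (ratMap f hf '' {x | (x : ProjSpace k m) ∈ V})

end ProjSpace

/-- The Jacobian matrix `J(f)`, with entry `∂f_i/∂X_j` in row `i` and column `j`. -/
noncomputable def jacobianMat {k : Type*} [Field k] {m n : ℕ}
    (f : Fin (n + 1) → MvPolynomial (Fin (m + 1)) k) :
    Matrix (Fin (n + 1)) (Fin (m + 1)) (MvPolynomial (Fin (m + 1)) k) :=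
  Matrix.of fun i j => MvPolynomial.pderiv j (f i)

/-- The ideal `I_s(A)` generated by the `s`-minors of the matrix `A`: the determinants of the
square submatrices on `s` rows and `s` columns. It is zero if `A` has fewer than `s` rows or
columns. -/
def minorsIdeal {R : Type*} [CommRing R] {a b : ℕ} (s : ℕ) (A : Matrix (Fin a) (Fin b) R) :
    Ideal R :=
  Ideal.span {g | ∃ (e : Fin s ↪o Fin a) (c : Fin s ↪o Fin b), g = (A.submatrix e c).det}

/-! Let `A` be the coordinate ring of the cone over `V`, `K` its fraction field, `x` the generic
point and `y = f(x)`, with `y i ≠ 0`. Suppose some `(m-r+2)`-minor of the Jacobian is nonzero at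
`x`. A derivation of `K` killing all `y j` and the `x j` outside the columns of the minor then kills
the remaining `x j` by linear algebra, so `K` is separable algebraic over the field these elements
generate (`isAlgebraic_adjoin_of_minor_ne_zero`). This direction of the Jacobian criterion holds in
every characteristic.

That field is generated by the ratios `z = y / y i`, by `y i` itself and by `r - 1` of the `x j`, so
`trdeg K ≤ s + r` with `s = trdeg k[z]`. The ratios are affine coordinates on the image, so `s ≤ dim
φ(V)`, while the cone gives `trdeg K ≥ dim V + 1 = dim φ(V) + r + 1`: a contradiction. Only these
one-sided comparisons of topological and algebraic dimension are needed
(`topologicalKrullDim_add_one_le`, `ringKrullDim_le_topologicalKrullDim`). -/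

/-! ### Krull dimension and transcendence degree -/

theorem ringKrullDim_le_of_isIntegral (R S : Type*) [CommRing R] [CommRing S] [Algebra R S]
    [Algebra.IsIntegral R S] : ringKrullDim S ≤ ringKrullDim R := by
  refine Order.krullDim_le_of_strictMono (PrimeSpectrum.comap (algebraMap R S)) ?_
  intro I J hIJ
  exact Ideal.IsIntegral.comap_lt_comap hIJ

/-- Lying over and going up lift every chain of primes. -/
theorem ringKrullDim_le_of_isIntegral_of_injective (R S : Type*) [CommRing R] [CommRing S]
    [Algebra R S] [Algebra.IsIntegral R S] [FaithfulSMul R S] :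
    ringKrullDim R ≤ ringKrullDim S := by
  refine iSup_le fun p => ?_
  obtain ⟨Q, hQ, hQp⟩ := Ideal.nonempty_primesOver (S := S) (RelSeries.head p).asIdeal
  obtain ⟨q, hq, -⟩ := Ideal.exists_ltSeries_of_hasGoingUp p Q
  exact hq ▸ Order.LTSeries.length_le_krullDim q

/-- The Krull dimension of an affine domain is its transcendence degree. -/
theorem exists_ringKrullDim_eq_and_trdeg_eq (k A : Type*) [Field k] [CommRing A] [IsDomain A]
    [Algebra k A] [Algebra.FiniteType k A] :
    ∃ s : ℕ, ringKrullDim A = s ∧ Algebra.trdeg k A = s := by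
  obtain ⟨s, g, hg, hint⟩ := exists_integral_inj_algHom_of_fg k A
  algebraize [g.toRingHom]
  have : FaithfulSMul (MvPolynomial (Fin s) k) A := (faithfulSMul_iff_algebraMap_injective _ _).mpr hg
  have : Algebra.IsIntegral (MvPolynomial (Fin s) k) A := ⟨hint⟩
  have : IsScalarTower k (MvPolynomial (Fin s) k) A := .of_algebraMap_eq fun x => (g.commutes x).symm
  refine ⟨s, ?_, ?_⟩
  · rw [le_antisymm (ringKrullDim_le_of_isIntegral (MvPolynomial (Fin s) k) A)
      (ringKrullDim_le_of_isIntegral_of_injective (MvPolynomial (Fin s) k) A)]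
    simp [MvPolynomial.ringKrullDim_of_isNoetherianRing, ringKrullDim_eq_zero_of_field]
  · have h := lift_trdeg_add_eq k (MvPolynomial (Fin s) k) A
    rw [MvPolynomial.trdeg_of_isDomain, trdeg_eq_zero (R := MvPolynomial (Fin s) k)] at h
    have h' := congrArg Cardinal.toNat h
    have : Algebra.trdeg k A < Cardinal.aleph0 := trdeg_lt_aleph0_of_finiteType
    rw [← Cardinal.cast_toNat_of_lt_aleph0 this]
    simp at h'
    rw [h']

/-! ### The Jacobian criterion for algebraicity -/

section

variable {k K : Type*} [Field k] [Field K] [Algebra k K]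

open scoped IntermediateField.algebraAdjoinAdjoin in
theorem trdeg_le_trdeg_add_card (R : Subalgebra k K) {s : ℕ} (hs : Algebra.trdeg k R = s)
    (T : Finset K) [Algebra.IsAlgebraic (IntermediateField.adjoin k ((R : Set K) ∪ T)) K] :
    Algebra.trdeg k K ≤ s + T.card := by
  have h0 : Algebra.IsAlgebraic (Algebra.adjoin k ((R : Set K) ∪ T)) K :=
    (IsFractionRing.comap_isAlgebraic_iff
      (K := IntermediateField.adjoin k ((R : Set K) ∪ T))).mpr inferInstance
  have : Algebra.IsAlgebraic (Algebra.adjoin R (T : Set K)) K := by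
    refine ⟨fun x => ?_⟩
    refine IsAlgebraic.tower_top_of_subalgebra_le
      (B := (Algebra.adjoin R (T : Set K)).restrictScalars k) ?_ (h0.isAlgebraic x)
    refine Algebra.adjoin_le (Set.union_subset ?_ ?_)
    · intro y hy
      exact (Algebra.adjoin R (T : Set K)).algebraMap_mem ⟨y, hy⟩
    · exact Algebra.subset_adjoin
  have h1 := trdeg_add_eq k R (A := K)
  rw [← h1, hs]
  gcongr
  simpa using Algebra.IsAlgebraic.trdeg_le_cardinalMk R (T : Set K)

/-- Chain rule for a derivation along a polynomial. -/
theorem Derivation.map_aeval_mvPolynomial {σ M : Type*} [Fintype σ] [AddCommGroup M] [Module k M]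
    [Module K M] [IsScalarTower k K M] (D : Derivation k K M) (x : σ → K) (p : MvPolynomial σ k) :
    D (MvPolynomial.aeval x p) =
      ∑ j, MvPolynomial.aeval x (MvPolynomial.pderiv j p) • D (x j) := by
  classical
  induction p using MvPolynomial.induction_on with
  | C a => simp
  | add p q hp hq => simp [hp, hq, add_smul, Finset.sum_add_distrib]
  | mul_X p i hp =>
    simp [hp, add_smul, Finset.sum_add_distrib, MvPolynomial.pderiv_X, Pi.single_apply, mul_smul,
      Finset.smul_sum, smul_comm (x i), apply_ite, ite_smul]

/-- The kernel of a derivation is a subfield containing `k`. -/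
theorem Derivation.eq_zero_of_adjoin_eq_top {M : Type*} [AddCommGroup M] [Module k M] [Module K M]
    (D : Derivation k K M) {s : Set K} (hs : IntermediateField.adjoin k s = ⊤)
    (h : ∀ a ∈ s, D a = 0) : D = 0 := by
  ext z
  have hz : z ∈ IntermediateField.adjoin k s := hs ▸ IntermediateField.mem_top
  induction hz using IntermediateField.adjoin_induction with
  | mem x hx => exact h x hx
  | algebraMap x => simp
  | add x y _ _ hx hy => simp_all
  | inv x _ hx => simp_all [Derivation.leibniz_inv]
  | mul x y _ _ hx hy => simp_all

/-- If the minor of the Jacobian matrix of `f` at `x` with rows `e` and columns `c` does not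
vanish, then `k(x)` is algebraic over the field generated by all `f i (x)` and the `x j` for the
columns `j` outside the minor. -/
theorem isAlgebraic_adjoin_of_minor_ne_zero [Algebra.EssFiniteType k K] {ι σ τ : Type*} [Fintype σ]
    [Fintype τ] [DecidableEq τ] (x : σ → K) (hx : IntermediateField.adjoin k (Set.range x) = ⊤)
    (f : ι → MvPolynomial σ k) (e : τ → ι) (c : τ ↪ σ)
    (hdet : (Matrix.of fun p q =>
      MvPolynomial.aeval x (MvPolynomial.pderiv (c q) (f (e p)))).det ≠ 0) (F : IntermediateField k K)
    (hfF : ∀ i, MvPolynomial.aeval x (f i) ∈ F) (hxF : ∀ j ∉ Set.range c, x j ∈ F) :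
    Algebra.IsAlgebraic F K := by
  have hess : Algebra.EssFiniteType F K := .of_comp k F K
  let D : Derivation k K (Ω[K⁄F]) := (KaehlerDifferential.D F K).restrictScalars k
  have hD0 (y : K) (hy : y ∈ F) : D y = 0 := (KaehlerDifferential.D F K).map_algebraMap ⟨y, hy⟩
  -- Applying a functional `φ` on the differentials to the chain rule for each `f (e p)` shows that
  -- the vector of the `φ (D (x (c q)))` is killed by the invertible minor; the columns outside it
  -- contribute nothing.
  have hDc (q : τ) : D (x (c q)) = 0 := by
    rw [← Module.forall_dual_apply_eq_zero_iff K]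
    intro φ
    refine congrFun (Matrix.eq_zero_of_mulVec_eq_zero hdet (v := fun q => φ (D (x (c q)))) ?_) q
    funext p
    have h := congrArg φ (hD0 _ (hfF (e p)))
    rw [D.map_aeval_mvPolynomial, map_sum, map_zero] at h
    rw [Pi.zero_apply, ← h]
    simp only [map_smul, smul_eq_mul, Matrix.mulVec, dotProduct, Matrix.of_apply]
    rw [← Finset.sum_map Finset.univ c
      fun j => MvPolynomial.aeval x (MvPolynomial.pderiv j (f (e p))) * φ (D (x j))]
    refine Finset.sum_subset (Finset.subset_univ _) fun j _ hj => ?_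
    rw [hD0 _ (hxF j (by simpa using hj)), map_zero, mul_zero]
  have hD : D = 0 := by
    refine D.eq_zero_of_adjoin_eq_top hx ?_
    rintro _ ⟨j, rfl⟩
    by_cases hj : j ∈ Set.range c
    · obtain ⟨q, rfl⟩ := hj
      exact hDc q
    · exact hD0 _ (hxF j hj)
  -- As `D` is the universal derivation over `F`, its vanishing gives `Ω[K⁄F] = 0`; for an
  -- essentially finite extension this means separable algebraic.
  have hunr : Algebra.FormallyUnramified F K := by
    refine ⟨?_⟩
    rw [← Submodule.subsingleton_iff K, ← subsingleton_iff_bot_eq_top,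
      ← KaehlerDifferential.span_range_derivation, eq_comm, Submodule.span_eq_bot]
    rintro _ ⟨y, rfl⟩
    exact DFunLike.congr_fun hD y
  have := (Algebra.FormallyUnramified.iff_isSeparable F K).mp hunr
  infer_instance

end

theorem isIrreducible_of_isIrreducible_image {X : Type*} [TopologicalSpace X] {W : Set X}
    {C : Set W} (h : IsIrreducible (Subtype.val '' C)) : IsIrreducible C := by
  refine ⟨h.nonempty.of_image, isPreirreducible_iff_isClosed_union_isClosed.mpr ?_⟩
  intro Z Z' hZ hZ' hC
  obtain ⟨Y, hY, rfl⟩ := isClosed_induced_iff.mp hZ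
  obtain ⟨Y', hY', rfl⟩ := isClosed_induced_iff.mp hZ'
  rw [← Set.preimage_union, ← Set.image_subset_iff] at hC
  simpa only [Set.image_subset_iff] using
    isPreirreducible_iff_isClosed_union_isClosed.mp h.isPreirreducible Y Y' hY hY' hC

/-! ### Upper bound for dimension: the affine cone -/

namespace ProjSpace

open MvPolynomial

variable {k : Type*} [Field k] {m : ℕ}

/-- `g` vanishes on the cone over `C`. -/
def VanishesOn (g : MvPolynomial (Fin (m + 1)) k) (C : Set (ProjSpace k m)) : Prop :=
  ∀ (v : Fin (m + 1) → k) (hv : v ≠ 0), mk v hv ∈ C → eval v g = 0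

theorem VanishesOn.mono {g : MvPolynomial (Fin (m + 1)) k} {C D : Set (ProjSpace k m)}
    (hg : VanishesOn g D) (h : C ⊆ D) : VanishesOn g C :=
  fun v hv hC => hg v hv (h hC)

theorem vanishesOn_iff_subset_zeroLocus {g : MvPolynomial (Fin (m + 1)) k}
    {C : Set (ProjSpace k m)} : VanishesOn g C ↔ C ⊆ zeroLocus {g} := by
  constructor
  · rintro h x hx g rfl v hv rfl
    exact h v hv hx
  · intro h v hv hx
    exact h hx g rfl v hv rfl

theorem isClosed_zeroLocus_singleton {g : MvPolynomial (Fin (m + 1)) k}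
    (hg : ∃ d, g.IsHomogeneous d) : IsClosed (zeroLocus {g}) :=
  isClosed_iff.mpr ⟨{g}, by simpa using hg, rfl⟩

theorem VanishesOn.closure {g : MvPolynomial (Fin (m + 1)) k} (hg : ∃ d, g.IsHomogeneous d)
    {C : Set (ProjSpace k m)} (h : VanishesOn g C) : VanishesOn g (closure C) := by
  rw [vanishesOn_iff_subset_zeroLocus] at h ⊢
  exact closure_minimal h (isClosed_zeroLocus_singleton hg)

theorem subset_of_vanishesOn {C Z : Set (ProjSpace k m)} (hZ : IsClosed Z)
    (h : ∀ g : MvPolynomial (Fin (m + 1)) k, (∃ d, g.IsHomogeneous d) → VanishesOn g Z →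
      VanishesOn g C) : C ⊆ Z := by
  obtain ⟨S, hS, rfl⟩ := isClosed_iff.mp hZ
  rintro x hx g hg v hv rfl
  exact h g (hS g hg) (fun w hw hwx => hwx g hg w hw rfl) v hv hx

theorem isIrreducible_of_vanishesOn_or {C : Set (ProjSpace k m)} (hne : C.Nonempty)
    (h : ∀ g g' : MvPolynomial (Fin (m + 1)) k, (∃ d, g.IsHomogeneous d) →
      (∃ d, g'.IsHomogeneous d) → VanishesOn (g * g') C → VanishesOn g C ∨ VanishesOn g' C) :
    IsIrreducible C := by
  refine ⟨hne, isPreirreducible_iff_isClosed_union_isClosed.mpr fun Z Z' hZ hZ' hC => ?_⟩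
  by_contra! hc
  obtain ⟨h1, h2⟩ := hc
  have h1' := mt (subset_of_vanishesOn hZ) h1
  have h2' := mt (subset_of_vanishesOn hZ') h2
  push Not at h1' h2'
  obtain ⟨g, hg, hgZ, hgC⟩ := h1'
  obtain ⟨g', hg', hgZ', hgC'⟩ := h2'
  refine (h g g' hg hg' fun v hv hvC => ?_).elim hgC hgC'
  rw [map_mul]
  rcases hC hvC with h | h
  · rw [hgZ v hv h, zero_mul]
  · rw [hgZ' v hv h, mul_zero]

/-- The homogeneous ideal generated by the homogeneous polynomials that vanish on `C`. -/
noncomputable def homogeneousVanishingIdeal (C : Set (ProjSpace k m)) : Ideal (MvPolynomial (Fin (m + 1)) k) :=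
  Ideal.span {g | (∃ d, g.IsHomogeneous d) ∧ VanishesOn g C}

theorem vanishesOn_of_mem {C : Set (ProjSpace k m)} {g : MvPolynomial (Fin (m + 1)) k}
    (hg : g ∈ homogeneousVanishingIdeal C) : VanishesOn g C := by
  intro v hv hvC
  have : homogeneousVanishingIdeal C ≤ RingHom.ker (eval v) :=
    Ideal.span_le.mpr fun g hg => hg.2 v hv hvC
  exact this hg

theorem mem_homogeneousVanishingIdeal {C : Set (ProjSpace k m)} {g : MvPolynomial (Fin (m + 1)) k}
    (hg : ∃ d, g.IsHomogeneous d) : g ∈ homogeneousVanishingIdeal C ↔ VanishesOn g C :=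
  ⟨vanishesOn_of_mem, fun h => Ideal.subset_span ⟨hg, h⟩⟩

theorem homogeneousVanishingIdeal_anti {C D : Set (ProjSpace k m)} (h : C ⊆ D) :
    homogeneousVanishingIdeal D ≤ homogeneousVanishingIdeal C :=
  Ideal.span_mono fun _ hg => ⟨hg.1, hg.2.mono h⟩

theorem homogeneousVanishingIdeal_lt {C D : Set (ProjSpace k m)} (hC : IsClosed C) (h : C ⊂ D) :
    homogeneousVanishingIdeal D < homogeneousVanishingIdeal C := by
  refine lt_of_le_not_ge (homogeneousVanishingIdeal_anti h.subset) fun hle => h.not_subset ?_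
  exact subset_of_vanishesOn hC fun g hg hgC =>
    vanishesOn_of_mem (hle ((mem_homogeneousVanishingIdeal hg).mpr hgC))

/-- For a homogeneous ideal, primality need only be tested on homogeneous elements, whose zero loci
are closed. -/
theorem isPrime_homogeneousVanishingIdeal {C : Set (ProjSpace k m)} (hC : IsIrreducible C) :
    (homogeneousVanishingIdeal C).IsPrime := by
  let := gradedAlgebra (σ := Fin (m + 1)) (R := k)
  have hhom : (homogeneousVanishingIdeal C).IsHomogeneous
      (homogeneousSubmodule (Fin (m + 1)) k) :=
    Ideal.homogeneous_span _ _ fun g hg => hg.1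
  refine hhom.isPrime_of_homogeneous_mem_or_mem ?_ ?_
  · intro htop
    obtain ⟨x, hx⟩ := hC.nonempty
    have h1 : (1 : MvPolynomial (Fin (m + 1)) k) ∈ homogeneousVanishingIdeal C := htop ▸ trivial
    simpa using vanishesOn_of_mem h1 x.rep x.rep_ne_zero (by rwa [x.mk_rep])
  · rintro g g' (hg : ∃ d, g.IsHomogeneous d) (hg' : ∃ d, g'.IsHomogeneous d) hgg'
    have hsub : C ⊆ zeroLocus {g} ∪ zeroLocus {g'} := by
      intro x hx
      have h0 := vanishesOn_of_mem hgg' x.rep x.rep_ne_zero (by rwa [x.mk_rep])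
      rw [map_mul, mul_eq_zero] at h0
      exact h0.imp
        (fun h => (mem_zeroLocus_iff (by simpa using hg) x).mpr (by simpa using h))
        (fun h => (mem_zeroLocus_iff (by simpa using hg') x).mpr (by simpa using h))
    rw [mem_homogeneousVanishingIdeal hg, mem_homogeneousVanishingIdeal hg',
      vanishesOn_iff_subset_zeroLocus, vanishesOn_iff_subset_zeroLocus]
    exact isPreirreducible_iff_isClosed_union_isClosed.mp hC.isPreirreducible _ _
      (isClosed_zeroLocus_singleton hg) (isClosed_zeroLocus_singleton hg') hsub

theorem homogeneousVanishingIdeal_lt_ker_constantCoeff {C : Set (ProjSpace k m)}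
    (hC : C.Nonempty) :
    homogeneousVanishingIdeal C < RingHom.ker (constantCoeff (R := k) (σ := Fin (m + 1))) := by
  obtain ⟨x, hx⟩ := hC
  rw [← x.mk_rep] at hx
  refine lt_of_le_not_ge (Ideal.span_le.mpr ?_) fun hle => x.rep_ne_zero ?_
  · rintro g ⟨⟨d, hd⟩, hg⟩
    have h0 := hg _ x.rep_ne_zero hx
    rw [SetLike.mem_coe, RingHom.mem_ker]
    rcases eq_or_ne d 0 with rfl | hd0
    · obtain ⟨c, rfl⟩ : ∃ c, g = MvPolynomial.C c := ⟨_, totalDegree_eq_zero_iff_eq_C.mp (by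
        simpa using hd.totalDegree_le)⟩
      simpa using h0
    · rw [constantCoeff_eq]
      exact hd.coeff_eq_zero (by simpa using hd0.symm)
  · funext j
    have hj : (X j : MvPolynomial (Fin (m + 1)) k) ∈ homogeneousVanishingIdeal C :=
      hle (by simp)
    simpa using vanishesOn_of_mem hj _ x.rep_ne_zero hx

/-- A chain of irreducible closed subsets of `V` gives a chain of homogeneous primes, which the
irrelevant ideal prolongs by one step: the vertex of the cone. -/
theorem topologicalKrullDim_add_one_le {V : Set (ProjSpace k m)} (hVclosed : IsClosed V)
    (hV : V.Nonempty) : topologicalKrullDim V + 1 ≤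
      ringKrullDim (MvPolynomial (Fin (m + 1)) k ⧸ homogeneousVanishingIdeal V) := by
  have hmem (C : Set (ProjSpace k m)) (hC : C ⊆ V) :
      (homogeneousVanishingIdeal V : Set (MvPolynomial (Fin (m + 1)) k)) ⊆
        homogeneousVanishingIdeal C := homogeneousVanishingIdeal_anti hC
  have hirr (c : TopologicalSpace.IrreducibleCloseds V) :
      IsIrreducible (Subtype.val '' (c : Set V)) :=
    c.isIrreducible.image _ continuous_subtype_val.continuousOn
  let Φ : TopologicalSpace.IrreducibleCloseds V →
      PrimeSpectrum.zeroLocus (homogeneousVanishingIdeal V : Set (MvPolynomial (Fin (m + 1)) k)) :=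
    fun c => ⟨⟨_, isPrime_homogeneousVanishingIdeal (hirr c)⟩,
      hmem _ (Subtype.coe_image_subset V c)⟩
  let t : PrimeSpectrum.zeroLocus
      (homogeneousVanishingIdeal V : Set (MvPolynomial (Fin (m + 1)) k)) :=
    ⟨⟨RingHom.ker constantCoeff, RingHom.ker_isPrime _⟩,
      (homogeneousVanishingIdeal_lt_ker_constantCoeff hV).le⟩
  rw [ringKrullDim_quotient, topologicalKrullDim, ← Order.krullDim_orderDual]
  rcases isEmpty_or_nonempty (TopologicalSpace.IrreducibleCloseds V)ᵒᵈ with hE | hE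
  · rw [Order.krullDim_eq_bot, WithBot.bot_add]
    exact bot_le
  -- The added top element is sent to the irrelevant ideal `t`.
  rw [← Order.krullDim_WithTop]
  refine Order.krullDim_le_of_strictMono
    (WithTop.recTopCoe t fun c => Φ (OrderDual.ofDual c)) (WithTop.strictMono_iff.mpr ⟨?_, ?_⟩)
  · intro c c' hc
    change homogeneousVanishingIdeal _ < homogeneousVanishingIdeal _
    refine homogeneousVanishingIdeal_lt
      (hVclosed.isClosedEmbedding_subtypeVal.isClosedMap _ c'.ofDual.isClosed) ?_
    exact Subtype.val_injective.image_strictMono (show (c'.ofDual : Set V) ⊂ c.ofDual from hc)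
  · intro c
    exact homogeneousVanishingIdeal_lt_ker_constantCoeff (hirr _).nonempty

/-! ### Lower bound for dimension: the chart `X i = 1` -/

/-- Every polynomial is congruent to a homogeneous one modulo `X i - 1`. -/
theorem exists_isHomogeneous_sub_mem {σ : Type*} (i : σ) (h : MvPolynomial σ k) :
    ∃ H : MvPolynomial σ k, (∃ d, H.IsHomogeneous d) ∧
      ∀ p : Ideal (MvPolynomial σ k), X i - 1 ∈ p → H - h ∈ p := by
  refine ⟨∑ d ∈ Finset.range (h.totalDegree + 1),
    X i ^ (h.totalDegree - d) * homogeneousComponent d h, ⟨h.totalDegree, ?_⟩, ?_⟩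
  · refine IsHomogeneous.sum _ _ _ fun d hd => ?_
    have := (isHomogeneous_X_pow (R := k) i (h.totalDegree - d)).mul
      (homogeneousComponent_isHomogeneous d h)
    rwa [Nat.sub_add_cancel (Nat.lt_succ_iff.mp (Finset.mem_range.mp hd))] at this
  · intro p hp
    nth_rw 4 [← sum_homogeneousComponent h]
    rw [← Finset.sum_sub_distrib]
    refine p.sum_mem fun d _ => ?_
    rw [← sub_one_mul]
    refine p.mul_mem_right _ (p.mem_of_dvd ?_ hp)
    exact sub_one_dvd_pow_sub_one _ _

/-- The projective closure of the points with coordinates in the affine zero locus of `p`. -/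
def affineZeroLocusClosure (p : Ideal (MvPolynomial (Fin (m + 1)) k)) : Set (ProjSpace k m) :=
  closure {x | ∃ (v : Fin (m + 1) → k) (hv : v ≠ 0), v ∈ MvPolynomial.zeroLocus k p ∧ mk v hv = x}

theorem affineZeroLocusClosure_anti {p p' : Ideal (MvPolynomial (Fin (m + 1)) k)} (h : p ≤ p') :
    affineZeroLocusClosure p' ⊆ affineZeroLocusClosure p := by
  refine closure_mono ?_
  rintro _ ⟨v, hv, hvp, rfl⟩
  exact ⟨v, hv, fun g hg => hvp g (h hg), rfl⟩

/-- This is the Nullstellensatz for `p`; `X i - 1 ∈ p` keeps its zeros away from the origin, so that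
they all define projective points. -/
theorem vanishesOn_affineZeroLocusClosure_iff [IsAlgClosed k]
    {p : Ideal (MvPolynomial (Fin (m + 1)) k)} (hp : p.IsPrime) {i : Fin (m + 1)}
    (hi : X i - 1 ∈ p) {g : MvPolynomial (Fin (m + 1)) k} (hg : ∃ d, g.IsHomogeneous d) :
    VanishesOn g (affineZeroLocusClosure p) ↔ g ∈ p := by
  constructor
  · intro h
    rw [← MvPolynomial.IsPrime.vanishingIdeal_zeroLocus (K := k) p,
      MvPolynomial.mem_vanishingIdeal_iff]
    intro v hv
    have hv0 : v ≠ 0 := by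
      rintro rfl
      simpa using hv _ hi
    rw [aeval_eq_eval]
    exact h v hv0 (subset_closure ⟨v, hv0, hv, rfl⟩)
  · intro h
    refine VanishesOn.closure hg ?_
    rintro v hv ⟨w, hw, hwp, hwv⟩
    obtain ⟨d, hd⟩ := hg
    rw [← eval_eq_zero_iff_of_mk_eq hd hwv, ← aeval_eq_eval]
    exact hwp g h

theorem isIrreducible_affineZeroLocusClosure [IsAlgClosed k]
    {p : Ideal (MvPolynomial (Fin (m + 1)) k)} (hp : p.IsPrime) {i : Fin (m + 1)}
    (hi : X i - 1 ∈ p) : IsIrreducible (affineZeroLocusClosure p) := by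
  refine isIrreducible_of_vanishesOn_or ?_ fun g g' hg hg' h => ?_
  · by_contra hne
    refine hp.ne_top ((Ideal.eq_top_iff_one p).mpr ?_)
    rw [← vanishesOn_affineZeroLocusClosure_iff hp hi ⟨0, isHomogeneous_one _ _⟩]
    intro v hv hvp
    exact (hne ⟨_, hvp⟩).elim
  · have hgg' : ∃ d, (g * g').IsHomogeneous d :=
      ⟨_, hg.choose_spec.mul hg'.choose_spec⟩
    rw [vanishesOn_affineZeroLocusClosure_iff hp hi hgg'] at h
    rw [vanishesOn_affineZeroLocusClosure_iff hp hi hg,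
      vanishesOn_affineZeroLocusClosure_iff hp hi hg']
    exact hp.mem_or_mem h

/-- Homogenizing an element of `p' \ p` with respect to `X i` does not change its class modulo
either prime, so a homogeneous polynomial separates the two closures. -/
theorem affineZeroLocusClosure_ssubset [IsAlgClosed k]
    {p p' : Ideal (MvPolynomial (Fin (m + 1)) k)} (hp : p.IsPrime) (hp' : p'.IsPrime)
    {i : Fin (m + 1)} (hi : X i - 1 ∈ p) (h : p < p') :
    affineZeroLocusClosure p' ⊂ affineZeroLocusClosure p := by
  refine ⟨affineZeroLocusClosure_anti h.le, fun hle => ?_⟩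
  obtain ⟨g, hgp', hgp⟩ := Set.exists_of_ssubset h
  obtain ⟨H, hH, hHg⟩ := exists_isHomogeneous_sub_mem i g
  refine hgp ((Submodule.sub_mem_iff_right p ?_).mp (hHg p hi))
  rw [← vanishesOn_affineZeroLocusClosure_iff hp hi hH]
  refine VanishesOn.mono ?_ hle
  rw [vanishesOn_affineZeroLocusClosure_iff hp' (h.le hi) hH]
  exact (Submodule.sub_mem_iff_left p' hgp').mp (hHg p' (h.le hi))

/-- Projective closure turns chains of primes over `q` into chains of irreducible closed subsets of
`W`, reversing the order. -/
theorem ringKrullDim_le_topologicalKrullDim [IsAlgClosed k] {W : Set (ProjSpace k m)}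
    (hW : IsClosed W) (q : Ideal (MvPolynomial (Fin (m + 1)) k)) (i : Fin (m + 1))
    (hi : X i - 1 ∈ q)
    (hWq : ∀ g : MvPolynomial (Fin (m + 1)) k, (∃ d, g.IsHomogeneous d) → VanishesOn g W →
      g ∈ q) :
    ringKrullDim (MvPolynomial (Fin (m + 1)) k ⧸ q) ≤ topologicalKrullDim W := by
  have hsub (p : PrimeSpectrum.zeroLocus (q : Set (MvPolynomial (Fin (m + 1)) k))) :
      affineZeroLocusClosure p.1.asIdeal ⊆ W := subset_of_vanishesOn hW fun g hg hgW =>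
    (vanishesOn_affineZeroLocusClosure_iff p.1.isPrime (p.2 hi) hg).mpr (p.2 (hWq g hg hgW))
  have himage (p : PrimeSpectrum.zeroLocus (q : Set (MvPolynomial (Fin (m + 1)) k))) :
      Subtype.val '' (Subtype.val ⁻¹' affineZeroLocusClosure p.1.asIdeal : Set W) =
        affineZeroLocusClosure p.1.asIdeal := by
    rw [Subtype.image_preimage_coe, Set.inter_eq_right.mpr (hsub p)]
  let Φ : PrimeSpectrum.zeroLocus (q : Set (MvPolynomial (Fin (m + 1)) k)) →
      (TopologicalSpace.IrreducibleCloseds W)ᵒᵈ := fun p => OrderDual.toDual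
    { carrier := Subtype.val ⁻¹' affineZeroLocusClosure p.1.asIdeal
      isIrreducible' := isIrreducible_of_isIrreducible_image (by
        rw [himage]
        exact isIrreducible_affineZeroLocusClosure p.1.isPrime (p.2 hi))
      isClosed' := isClosed_closure.preimage continuous_subtype_val }
  rw [ringKrullDim_quotient, topologicalKrullDim, ← Order.krullDim_orderDual
    (α := TopologicalSpace.IrreducibleCloseds W)]
  refine Order.krullDim_le_of_strictMono Φ fun p p' hpp' => ?_
  have hlt := affineZeroLocusClosure_ssubset p.1.isPrime p'.1.isPrime (p.2 hi) hpp'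
  rw [← himage p, ← himage p', Subtype.val_injective.injOn.image_ssubset_image_iff (Set.subset_univ _) (Set.subset_univ _)]
    at hlt
  exact hlt

end ProjSpace

/-! ### Equations of the closed image and the dimension count -/

namespace ProjSpace

open MvPolynomial

variable {k : Type*} [Field k] {m n : ℕ}

theorem exists_notMem_homogeneousVanishingIdeal
    {f : Fin (n + 1) → MvPolynomial (Fin (m + 1)) k} {d : ℕ} (hf : ∀ i, (f i).IsHomogeneous d)
    {V : Set (ProjSpace k m)} (hV : (V ∩ domain f).Nonempty) :
    ∃ i, f i ∉ homogeneousVanishingIdeal V := by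
  obtain ⟨x, hxV, hx⟩ := hV
  obtain ⟨i, hi⟩ := Function.ne_iff.mp (eval_ne_zero_of_mem_domain hf hx)
  exact ⟨i, fun h => hi (vanishesOn_of_mem h x.rep x.rep_ne_zero (by rwa [x.mk_rep]))⟩

/-- The factor `f i` takes care of the points of `V` outside the domain; where it is nonzero, the
point has an image on which `g` vanishes. -/
theorem VanishesOn.mul_aeval_mem {f : Fin (n + 1) → MvPolynomial (Fin (m + 1)) k} {d : ℕ}
    (hf : ∀ i, (f i).IsHomogeneous d) {V : Set (ProjSpace k m)}
    {g : MvPolynomial (Fin (n + 1)) k} (hg : ∃ e, g.IsHomogeneous e)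
    (h : VanishesOn g (closedImage f hf V)) (i : Fin (n + 1)) :
    f i * aeval f g ∈ homogeneousVanishingIdeal V := by
  obtain ⟨e, he⟩ := hg
  refine (mem_homogeneousVanishingIdeal ⟨_, (hf i).mul (he.aeval f hf)⟩).mpr fun v hv hvV => ?_
  rw [map_mul, mul_eq_zero, or_iff_not_imp_left]
  intro hi
  have hfv : (fun i => eval v (f i)) ≠ 0 := fun h0 => hi (congrFun h0 i)
  have hx : mk v hv ∈ domain f := fun h0 => hi (h0 _ ⟨i, rfl⟩ v hv rfl)
  have h1 := h _ hfv (subset_closure ⟨⟨mk v hv, hx⟩, hvV, ratMap_mk f hf v hv hx hfv⟩)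
  rw [← h1, ← aeval_eq_eval, ← aeval_eq_eval, ← AlgHom.comp_apply, comp_aeval]

end ProjSpace

theorem MvPolynomial.IsHomogeneous.aeval_smul {k K : Type*} [Field k] [Field K] [Algebra k K]
    {n e : ℕ} {g : MvPolynomial (Fin (n + 1)) k} (hg : g.IsHomogeneous e) (a : K)
    (v : Fin (n + 1) → K) :
    MvPolynomial.aeval (a • v) g = a ^ e * MvPolynomial.aeval v g := by
  simpa [MvPolynomial.eval_map, MvPolynomial.aeval_def] using
    ProjSpace.eval_smul_of_isHomogeneous (hg.map (algebraMap k K)) a v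

open MvPolynomial ProjSpace in
theorem ringKrullDim_range_aeval_le_topologicalKrullDim {k K : Type*} [Field k] [IsAlgClosed k]
    [Field K] [Algebra k K] {n : ℕ} {W : Set (ProjSpace k n)} (hW : IsClosed W)
    (z : Fin (n + 1) → K) {i : Fin (n + 1)} (hi : z i = 1)
    (hWz : ∀ g : MvPolynomial (Fin (n + 1)) k, (∃ d, g.IsHomogeneous d) → VanishesOn g W →
      aeval z g = 0) :
    ringKrullDim (aeval z : MvPolynomial (Fin (n + 1)) k →ₐ[k] K).range ≤
      topologicalKrullDim W := by
  rw [← ringKrullDim_eq_of_ringEquiv (Ideal.quotientKerAlgEquivOfSurjective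
    (aeval z : MvPolynomial (Fin (n + 1)) k →ₐ[k] K).rangeRestrict_surjective).toRingEquiv]
  refine ringKrullDim_le_topologicalKrullDim hW _ i ?_ fun g hg hgW => ?_
  · rw [RingHom.mem_ker]
    ext
    simp [hi]
  · rw [RingHom.mem_ker]
    ext
    exact hWz g hg hgW

open MvPolynomial ProjSpace in
theorem minor_mem_homogeneousVanishingIdeal {k : Type*} [Field k] [IsAlgClosed k] (m n d r : ℕ)
    (f : Fin (n + 1) → MvPolynomial (Fin (m + 1)) k)
    (hf : ∀ i, (f i).IsHomogeneous d)
    (V : Set (ProjSpace k m)) (hVclosed : IsClosed V) (hVirr : IsIrreducible V)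
    (hVdom : (V ∩ ProjSpace.domain f).Nonempty)
    (hr : topologicalKrullDim V = topologicalKrullDim (ProjSpace.closedImage f hf V) + r)
    (e : Fin (m - r + 2) ↪o Fin (n + 1)) (c : Fin (m - r + 2) ↪o Fin (m + 1)) :
    ((jacobianMat f).submatrix e c).det ∈ homogeneousVanishingIdeal V := by
  classical
  have hprime := isPrime_homogeneousVanishingIdeal hVirr
  set P := homogeneousVanishingIdeal V
  let A := MvPolynomial (Fin (m + 1)) k ⧸ P
  let K := FractionRing A
  let x : Fin (m + 1) → K := fun j => algebraMap A K (Ideal.Quotient.mk P (X j))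
  have hx (g : MvPolynomial (Fin (m + 1)) k) :
      aeval x g = algebraMap A K (Ideal.Quotient.mk P g) :=
    (DFunLike.congr_fun (comp_aeval X ((IsScalarTower.toAlgHom k A K).comp (Ideal.Quotient.mkₐ k P)))
      g).symm.trans (by simp; rfl)
  have hx0 (g : MvPolynomial (Fin (m + 1)) k) : aeval x g = 0 ↔ g ∈ P := by
    rw [hx, FaithfulSMul.algebraMap_eq_zero_iff, Ideal.Quotient.eq_zero_iff_mem]
  have hxtop : IntermediateField.adjoin k (Set.range x) = ⊤ := by
    have hmem (a : A) : algebraMap A K a ∈ IntermediateField.adjoin k (Set.range x) := by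
      obtain ⟨g, rfl⟩ := Ideal.Quotient.mk_surjective a
      rw [← hx]
      refine IntermediateField.algebra_adjoin_le_adjoin k _ ?_
      rw [Algebra.adjoin_range_eq_range_aeval]
      exact ⟨g, rfl⟩
    refine eq_top_iff.mpr fun w _ => ?_
    obtain ⟨a, b, -, rfl⟩ := IsFractionRing.div_surjective (A := A) w
    exact div_mem (hmem a) (hmem b)
  by_contra hminor
  obtain ⟨i, hi⟩ := exists_notMem_homogeneousVanishingIdeal hf hVdom
  let y : Fin (n + 1) → K := fun j => aeval x (f j)
  have hyi : y i ≠ 0 := mt (hx0 _).mp hi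
  let z : Fin (n + 1) → K := (y i)⁻¹ • y
  have hz : y i • z = y := smul_inv_smul₀ hyi y
  let R : Subalgebra k K := (aeval z).range
  -- `y i` recovers `y` from the ratios `z`; the rest are the coordinates outside the minor.
  let T : Finset K := insert (y i) ((Finset.univ.map c.toEmbedding)ᶜ.image x)
  have hT : T.card ≤ (m + 1 - (m - r + 2)) + 1 := by
    refine (Finset.card_insert_le _ _).trans (Nat.add_le_add_right ?_ 1)
    refine Finset.card_image_le.trans ?_
    rw [Finset.card_compl, Finset.card_map, Finset.card_univ, Fintype.card_fin, Fintype.card_fin]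
  -- Forces `r ≥ 1` when `r ≤ m`, so that `m + 1 - (m - r + 2)` really is `r - 1`.
  have hcard : m - r + 2 ≤ m + 1 := by
    simpa using Fintype.card_le_of_embedding c.toEmbedding
  let F : IntermediateField k K := IntermediateField.adjoin k ((R : Set K) ∪ T)
  have hRF (w : K) (hw : w ∈ R) : w ∈ F := IntermediateField.subset_adjoin _ _ (Or.inl hw)
  have hTF (w : K) (hw : w ∈ T) : w ∈ F := IntermediateField.subset_adjoin _ _ (Or.inr hw)
  have halg : Algebra.IsAlgebraic F K := by
    have : Algebra.EssFiniteType k K := .comp k A K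
    refine isAlgebraic_adjoin_of_minor_ne_zero x hxtop f e c.toEmbedding ?_ F ?_ ?_
    · rw [← hx0, AlgHom.map_det] at hminor
      exact hminor
    · intro j
      have hj : y i * z j ∈ F := mul_mem (hTF _ (Finset.mem_insert_self _ _))
        (hRF _ ⟨X j, aeval_X _ _⟩)
      rwa [← smul_eq_mul, ← Pi.smul_apply, hz] at hj
    · intro j hj
      refine hTF _ (Finset.mem_insert_of_mem (Finset.mem_image_of_mem _ ?_))
      simpa using hj
  have hR : Algebra.FiniteType k R :=
    Algebra.FiniteType.of_surjective (aeval z).rangeRestrict (aeval z).rangeRestrict_surjective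
  obtain ⟨s, hsdim, hstr⟩ := exists_ringKrullDim_eq_and_trdeg_eq k R
  obtain ⟨a, hadim, hatr⟩ := exists_ringKrullDim_eq_and_trdeg_eq k A
  have hK : Algebra.trdeg k K = a := by
    have : Algebra.IsAlgebraic A K := 
      (IsFractionRing.comap_isAlgebraic_iff (K := K)).mpr inferInstance
    rw [← trdeg_add_eq k A (A := K), trdeg_eq_zero (R := A), add_zero, hatr]
  have hle : a ≤ s + T.card := by
    have := trdeg_le_trdeg_add_card R hstr T
    rw [hK] at this
    exact_mod_cast this
  have hVdim : topologicalKrullDim V + 1 ≤ a :=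
    (topologicalKrullDim_add_one_le hVclosed hVirr.nonempty).trans_eq hadim
  -- With `s + r + 1 ≤ a` this gives `r ≤ m`, so the subtraction `m - r` is not truncated.
  have ham : a ≤ m + 1 := by
    have h := ringKrullDim_quotient_le P
    rw [hadim, MvPolynomial.ringKrullDim_of_isNoetherianRing, ringKrullDim_eq_zero_of_field] at h
    simpa using (by exact_mod_cast h : a ≤ 0 + Nat.card (Fin (m + 1)))
  have hWdim : (s : WithBot ℕ∞) ≤ topologicalKrullDim (closedImage f hf V) := by
    rw [← hsdim]
    refine ringKrullDim_range_aeval_le_topologicalKrullDim isClosed_closure z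
      (inv_mul_cancel₀ hyi) ?_
    -- Homogeneity passes the vanishing of `g` from `y` to its rescaling `z`.
    rintro g ⟨δ, hg⟩ hgW
    have h1 := (hx0 _).mpr (hgW.mul_aeval_mem hf ⟨δ, hg⟩ i)
    rw [map_mul, ← AlgHom.comp_apply, comp_aeval] at h1
    have h2 : aeval y g = 0 := (mul_eq_zero.mp h1).resolve_left hyi
    rw [← hz, hg.aeval_smul] at h2
    exact (mul_eq_zero.mp h2).resolve_left (pow_ne_zero _ hyi)
  rw [hr] at hVdim
  have hnum : ((s + r + 1 : ℕ) : WithBot ℕ∞) ≤ (a : WithBot ℕ∞) := by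
    refine le_trans ?_ hVdim
    push_cast
    gcongr
  have hnum' : s + r + 1 ≤ a := by exact_mod_cast hnum
  omega

theorem proposition1p3 {k : Type*} [Field k] [IsAlgClosed k] (m n d r : ℕ)
    (f : Fin (n + 1) → MvPolynomial (Fin (m + 1)) k)
    (hf : ∀ i, (f i).IsHomogeneous d)
    (hgcd : ∀ g : MvPolynomial (Fin (m + 1)) k, (∀ i, g ∣ f i) → IsUnit g)
    (V : Set (ProjSpace k m)) (hVclosed : IsClosed V) (hVirr : IsIrreducible V)
    (hVdom : (V ∩ ProjSpace.domain f).Nonempty)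
    (hr : topologicalKrullDim V = topologicalKrullDim (ProjSpace.closedImage f hf V) + r) :
    V ⊆ ProjSpace.zeroLocus
      (minorsIdeal (m - r + 2) (jacobianMat f) : Set (MvPolynomial (Fin (m + 1)) k)) := by
  have hle : minorsIdeal (m - r + 2) (jacobianMat f) ≤ ProjSpace.homogeneousVanishingIdeal V := by
    refine Ideal.span_le.mpr ?_
    rintro _ ⟨e, c, rfl⟩
    exact minor_mem_homogeneousVanishingIdeal m n d r f hf V hVclosed hVirr hVdom hr e c
  rintro p hp g hg v hv rfl
  exact ProjSpace.vanishesOn_of_mem (hle hg) v hv hp
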